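/- Let $s>0$ and let $x_1,\dots,x_{n_1}$ and $y_1,\dots,y_{n_2}$ be real numbers with no ties between the two samples, i.e. $x_j\neq y_k$ for all $j,k$. Write $Dp(s,G)$ for the law of the Dirichlet process on $\mathbb R$ with base measure $sG$, where $G$ is a probability measure on $\mathbb R$: for every finite measurable partition $B_1,\dots,B_m$ of $\mathbb R$ the vector $(P(B_1),\dots,P(B_m))$ has the Dirichlet distribution with parameters $(sG(B_1),\dots,sG(B_m))$. In the two-sample imprecise Dirichlet process (IDP) model of strength $s$, $F_X\sim Dp(s,G_1)$ and $F_Y\sim Dp(s,G_2)$ are independent, $G_1,G_2$ range over all probability measures on $\mathbb R$, and given $(F_X,F_Y)$ the samples $X^{n_1}$ and $Y^{n_2}$ are independent, i.i.d. from $F_X$ and from $F_Y$ respectively. The posterior of $(F_X,F_Y)$ given the data is taken in its usual version: given $X^{n_1}=(x_j)$ and $Y^{n_2}=(y_k)$, $F_X$ and $F_Y$ are independent Dirichlet processes with base measures $sG_1+\sum_j\delta_{x_j}$ and $sG_2+\sum_k\delta_{y_k}$. Put $P(X\le Y)=\int F_X(y)\,dF_Y(y)$, and let $\underline{\mathcal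 P}[P(X\le Y)>c\mid X^{n_1},Y^{n_2}]$ be the infimum over all $G_1,G_2$ of the posterior probability, given $X^{n_1}=(x_j)$ and $Y^{n_2}=(y_k)$, of the event $P(X\le Y)>c$. Let $(w_{i0},w_{i1},\dots,w_{in_i})\sim \mathrm{Dir}(s,1,\dots,1)$ (with $n_i$ ones) for $i=1,2$, independently, let $A$ be the $n_1\times n_2$ matrix with entries $a_{jk}=1$ if $x_j<y_k$ and $a_{jk}=0$ otherwise, let $W=(w_{11},\dots,w_{1n_1})^T$, $V=(w_{21},\dots,w_{2n_2})^T$, and $$g=\sum_{j=1}^{n_1}\sum_{k=1}^{n_2}w_{1j}w_{2k}\,a_{jk}.$$ Then for every $c\in[0,1]$ $$\underline{\mathcal P}[P(X\le Y)>c\mid X^{n_1},Y^{n_2}]=P[g>c].$$ Moreover $g$ is square-integrable, and its mean and variance are $$\mu=E[W]^TA\,E[V],\qquad \sigma^2=\mathrm{trace}\big(A^TE[WW^T]\,A\,E[VV^T]\big)-\mu^2,$$ where $E[WW^T]$ and $E[VV^T]$ are the $n_i\times n_i$ matrices ($i=1$ and $i=2$ respectively) with entries $e_{jk}=\dfrac{1+I_{\{j\}}(k)}{(s+n_i)(s+n_i+1)}$.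 -/

import Mathlib

open MeasureTheory ProbabilityTheory Matrix
open scoped ENNReal

namespace IDP

/-- The Gamma law with shape `a` and unit rate, with the usual convention that shape `0` is the
point mass at `0`. -/
noncomputable def gammaLaw (a : ℝ) : Measure ℝ :=
  if 0 < a then gammaMeasure a 1 else Measure.dirac 0

/-- The Dirichlet distribution with parameters `a i ≥ 0`, not all zero: the law of
`(Z i / ∑ j, Z j)` for independent `Z i` with Gamma law of shape `a i`. -/
noncomputable def dirichlet {ι : Type*} [Fintype ι] (a : ι → ℝ) : Measure (ι → ℝ) :=
  (Measure.pi fun i => gammaLaw (a i)).map fun z i => z i / ∑ j, z j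

/-- `Q` is the law of a Dirichlet process on `ℝ` with (unnormalised, finite) base measure `α`:
for every finite measurable partition `B`, the vector `(P (B i))` is Dirichlet with parameters
`α (B i)`.  The `σ`-algebra on `ProbabilityMeasure ℝ` is generated by the evaluations on
measurable sets; on `ℝ` it is the Borel `σ`-algebra of the weak topology. -/
def IsDirichletProcess (α : Measure ℝ) (Q : Measure (ProbabilityMeasure ℝ)) : Prop :=
  ∀ (m : ℕ) (B : Fin m → Set ℝ), (∀ i, MeasurableSet (B i)) →
    Pairwise (fun i j => Disjoint (B i) (B j)) → ⋃ i, B i = Set.univ →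
    Q.map (fun (P : ProbabilityMeasure ℝ) i => (P : Measure ℝ).real (B i)) = dirichlet fun i => α.real (B i)

/-- `Q` is the law `Dp(s, G)`, with prior strength `s` and normalised base measure `G`. -/
def IsDp (s : ℝ) (G : ProbabilityMeasure ℝ) (Q : Measure (ProbabilityMeasure ℝ)) : Prop :=
  IsDirichletProcess (ENNReal.ofReal s • (G : Measure ℝ)) Q

/-- The updated base measure `s G + ∑ i, δ_{x i}` after observing the sample `x`. -/
noncomputable def updatedBase (s : ℝ) (G : ProbabilityMeasure ℝ) {n : ℕ} (x : Fin n → ℝ) :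
    Measure ℝ :=
  ENNReal.ofReal s • (G : Measure ℝ) + ∑ i, Measure.dirac (x i)

theorem measurable_piMeasure (n : ℕ) :
    Measurable fun P : ProbabilityMeasure ℝ => Measure.pi fun _ : Fin n => (P : Measure ℝ) := by
  refine Measurable.measure_of_isPiSystem_of_isProbabilityMeasure
    generateFrom_pi.symm isPiSystem_pi ?_
  rintro _ ⟨t, ht, rfl⟩
  have ht' : ∀ i, MeasurableSet (t i) := fun i => ht i (Set.mem_univ i)
  simp only [Measure.pi_pi]
  refine Finset.measurable_prod _ fun i _ => ?_
  exact (Measure.measurable_coe (ht' i)).comp measurable_subtype_coe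

/-- The sampling model: given `(F_X, F_Y)`, the two samples are independent, the first one i.i.d.
from `F_X` with size `n₁`, the second one i.i.d. from `F_Y` with size `n₂`. -/
noncomputable def sampling (n₁ n₂ : ℕ) :
    Kernel (ProbabilityMeasure ℝ × ProbabilityMeasure ℝ) ((Fin n₁ → ℝ) × (Fin n₂ → ℝ)) where
  toFun F := (Measure.pi fun _ => (F.1 : Measure ℝ)).prod (Measure.pi fun _ => (F.2 : Measure ℝ))
  measurable' := by
    refine Measurable.measure_of_isPiSystem_of_isProbabilityMeasure
      generateFrom_prod.symm isPiSystem_prod ?_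
    rintro _ ⟨u, hu, v, hv, rfl⟩
    have hu' : MeasurableSet u := hu
    have hv' : MeasurableSet v := hv
    simp only [Measure.prod_prod]
    exact ((Measure.measurable_coe hu').comp ((measurable_piMeasure n₁).comp measurable_fst)).mul
      ((Measure.measurable_coe hv').comp ((measurable_piMeasure n₂).comp measurable_snd))

instance (n₁ n₂ : ℕ) : IsMarkovKernel (sampling n₁ n₂) :=
  ⟨fun F => inferInstanceAs (IsProbabilityMeasure
    ((Measure.pi fun _ => (F.1 : Measure ℝ)).prod (Measure.pi fun _ => (F.2 : Measure ℝ))))⟩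

/-- `κ` is a posterior law of `(F_X, F_Y)` given the two samples, for the prior law `Λ` of
`(F_X, F_Y)`: a regular conditional distribution of the parameter given the data. -/
def IsPosterior {n₁ n₂ : ℕ} (Λ : Measure (ProbabilityMeasure ℝ × ProbabilityMeasure ℝ))
    (κ : Kernel ((Fin n₁ → ℝ) × (Fin n₂ → ℝ)) (ProbabilityMeasure ℝ × ProbabilityMeasure ℝ)) :
    Prop :=
  IsMarkovKernel κ ∧
    (sampling n₁ n₂ ∘ₘ Λ) ⊗ₘ κ = (Λ ⊗ₘ sampling n₁ n₂).map Prod.swap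

/-- The posteriors of the imprecise Dirichlet process of strength `s` in the two-sample problem:
`F_X ∼ Dp(s, G₁)` and `F_Y ∼ Dp(s, G₂)` are independent a priori, with arbitrary `G₁`, `G₂`.
A conditional distribution is only unique up to null sets of data, so the version has to be
specified: it is the usual one, which at every data point `(x, y)` is the product of the
Dirichlet processes with base measures `s G₁ + ∑ δ_{x i}` and `s G₂ + ∑ δ_{y i}`. -/
def posteriors (s : ℝ) (n₁ n₂ : ℕ) :
    Set (Kernel ((Fin n₁ → ℝ) × (Fin n₂ → ℝ))
      (ProbabilityMeasure ℝ × ProbabilityMeasure ℝ)) :=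
  {κ | ∃ (G₁ G₂ : ProbabilityMeasure ℝ) (Q₁ Q₂ : Measure (ProbabilityMeasure ℝ)),
    IsDp s G₁ Q₁ ∧ IsDp s G₂ Q₂ ∧ IsPosterior (Q₁.prod Q₂) κ ∧
    ∀ (x : Fin n₁ → ℝ) (y : Fin n₂ → ℝ), ∃ R₁ R₂ : Measure (ProbabilityMeasure ℝ),
      IsDirichletProcess (updatedBase s G₁ x) R₁ ∧
      IsDirichletProcess (updatedBase s G₂ y) R₂ ∧
      κ (x, y) = R₁.prod R₂}

/-- `P(X ≤ Y)` for independent `X ∼ F.1` and `Y ∼ F.2`. -/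
noncomputable def probLE (F : ProbabilityMeasure ℝ × ProbabilityMeasure ℝ) : ℝ :=
  ((F.1 : Measure ℝ).prod (F.2 : Measure ℝ)).real {p | p.1 ≤ p.2}

/-- The values at the data `(x, y)` of the posterior probability of the event `P(X ≤ Y) > c`,
over all posteriors of the imprecise Dirichlet process. -/
def posteriorProbs (s c : ℝ) {n₁ n₂ : ℕ} (x : Fin n₁ → ℝ) (y : Fin n₂ → ℝ) : Set ℝ :=
  {p | ∃ κ ∈ posteriors s n₁ n₂, p = (κ (x, y)).real {F | c < probLE F}}

/-- The posterior lower probability of the event `P(X ≤ Y) > c`. -/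
noncomputable def lowerProb (s c : ℝ) {n₁ n₂ : ℕ} (x : Fin n₁ → ℝ) (y : Fin n₂ → ℝ) : ℝ :=
  sInf (posteriorProbs s c x y)

/-- The distribution `Dir(s, 1, …, 1)` of the weights `(w 0, w 1, …, w n)`. -/
noncomputable def weightLaw (s : ℝ) (n : ℕ) : Measure (Fin (n + 1) → ℝ) :=
  dirichlet (Fin.cons s fun _ => 1)

/-- The matrix with entries `1` where `x j < y k` and `0` elsewhere. -/
noncomputable def compMatrix {n₁ n₂ : ℕ} (x : Fin n₁ → ℝ) (y : Fin n₂ → ℝ) :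
    Matrix (Fin n₁) (Fin n₂) ℝ :=
  Matrix.of fun j k => (Set.Ioi (x j)).indicator (fun _ => 1) (y k)

/-- `g = ∑ j, ∑ k, w₁ⱼ w₂ₖ I(x j < y k)`, where the weights `w₁₀` and `w₂₀` do not occur. -/
noncomputable def g {n₁ n₂ : ℕ} (x : Fin n₁ → ℝ) (y : Fin n₂ → ℝ)
    (w : (Fin (n₁ + 1) → ℝ) × (Fin (n₂ + 1) → ℝ)) : ℝ :=
  ∑ j : Fin n₁, ∑ k : Fin n₂,
    w.1 j.succ * w.2 k.succ * (Set.Ioi (x j)).indicator (fun _ => 1) (y k)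

/-- `E[W]` for `W = (w 1, …, w n)`. -/
noncomputable def meanVec (s : ℝ) (n : ℕ) : Fin n → ℝ :=
  fun j => ∫ w, w j.succ ∂(weightLaw s n)

/-- `E[W Wᵀ]` for `W = (w 1, …, w n)`. -/
noncomputable def secondMoment (s : ℝ) (n : ℕ) : Matrix (Fin n) (Fin n) ℝ :=
  Matrix.of fun j k => ∫ w, w j.succ * w k.succ ∂(weightLaw s n)

end IDP

/-! The lower probability is attained at the degenerate priors `G₁ = δ_N` and `G₂ = δ_{-N}`, where
`-N < x j` and `y k < N` for all `j`, `k`. A Dirichlet process whose base measure has finitely many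
atoms is the random discrete measure on these atoms with Dirichlet weights
(`isDirichletProcess_atomicKernel`), so under these priors `P(X ≤ Y)` is a double sum over pairs of
atoms. The prior atom of `X` lies above, and the prior atom of `Y` below, everything it is compared
with, so that only pairs of observations contribute; by the absence of ties the sum is `g`
(`probLE_atomic_cons`). These priors make the data almost surely constant, hence the family of
Dirichlet posteriors is a regular conditional distribution (`isPosterior_atomicKernel`), and
`posteriors` is nonempty.

For arbitrary `G₁` and `G₂`, `P(X ≤ Y)` is at least the contribution of pairs of atoms at the sample
points (`g_blockMass_le_probLE`), and a coupling compares this with `g`. A Dirichlet vector indexed by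
`Fin (n + 1) ⊕ Fin n`, with one coordinate for the prior mass of each block of the partition of `ℝ`
induced by the sample and one for each observation, can be lumped in two ways: adding every
observation to its block gives the random block masses (`map_blockMass`), lumping all prior mass
together gives the weights `Dir(s, 1, …, 1)` (`weightLaw_eq_map`). Under this coupling the former
dominate the latter on the sample points, so the posterior probability is at least `P[g > c]`
(`le_posterior_prob`).

Both parts rest on the lumping property of the Dirichlet distribution (`map_fiberSum_dirichlet`),
which is the additivity of Gamma variables (`gammaLaw_conv`, by moment-generating functions).
Lumping also reduces the second moments of the weights to those of a ratio `Z₁ / (Z₁ + Z₂)` of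
independent Gamma variables, and these follow from the size-biasing identity
`E[Z f(Z)] = a E[f(Z')]`, where `Z` has shape `a` and `Z'` has shape `a + 1`. -/

namespace IDP

/-! ### Gamma laws -/

theorem gammaMeasure_eq_withDensity_Ioi (a : ℝ) :
    gammaMeasure a 1 = (volume.restrict (Set.Ioi 0)).withDensity
      fun x => ENNReal.ofReal ((Real.Gamma a)⁻¹ * (x ^ (a - 1) * Real.exp (-x))) := by
  rw [← withDensity_indicator measurableSet_Ioi, gammaMeasure]
  refine withDensity_congr_ae ?_
  have h0 : ∀ᵐ x : ℝ, x ≠ 0 := by simp [ae_iff]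
  filter_upwards [h0] with x hx
  rcases lt_or_gt_of_ne hx with h | h
  · rw [gammaPDF_of_neg h, Set.indicator_of_notMem (by simpa using h.le)]
  · rw [gammaPDF_of_nonneg h.le, Set.indicator_of_mem (by simpa using h)]
    simp [mul_assoc]

theorem integral_gammaMeasure {a : ℝ} (ha : 0 < a) (f : ℝ → ℝ) :
    ∫ x, f x ∂gammaMeasure a 1 =
      (Real.Gamma a)⁻¹ * ∫ x in Set.Ioi 0, x ^ (a - 1) * Real.exp (-x) * f x := by
  rw [gammaMeasure_eq_withDensity_Ioi, integral_withDensity_eq_integral_toReal_smul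
    (by fun_prop) (by simp), ← integral_const_mul]
  refine setIntegral_congr_fun measurableSet_Ioi fun x hx => ?_
  have hx : 0 < x := hx
  have := Real.Gamma_pos_of_pos ha
  simp only [smul_eq_mul]
  rw [ENNReal.toReal_ofReal (by positivity)]
  ring

theorem integrable_gammaMeasure_iff {a : ℝ} (ha : 0 < a) (f : ℝ → ℝ) :
    Integrable f (gammaMeasure a 1) ↔
      IntegrableOn (fun x => x ^ (a - 1) * Real.exp (-x) * f x) (Set.Ioi 0) := by
  have h := Real.Gamma_pos_of_pos ha
  rw [gammaMeasure_eq_withDensity_Ioi, integrable_withDensity_iff_integrable_smul'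
    (by fun_prop) (by simp), IntegrableOn]
  refine (integrable_congr ?_).trans
    (integrable_const_mul_iff (c := (Real.Gamma a)⁻¹) (by simpa using h.ne') _)
  filter_upwards [ae_restrict_mem measurableSet_Ioi] with x hx
  have hx : 0 < x := hx
  simp only [smul_eq_mul]
  rw [ENNReal.toReal_ofReal (by positivity)]
  ring

/-- Size-biasing a Gamma variable raises its shape by one. -/
theorem integral_mul_gammaMeasure {a : ℝ} (ha : 0 < a) (f : ℝ → ℝ) :
    ∫ x, x * f x ∂gammaMeasure a 1 = a * ∫ x, f x ∂gammaMeasure (a + 1) 1 := by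
  rw [integral_gammaMeasure ha, integral_gammaMeasure (by linarith), Real.Gamma_add_one ha.ne',
    mul_inv, ← mul_assoc, ← mul_assoc, mul_inv_cancel₀ ha.ne', one_mul]
  congr 1
  refine setIntegral_congr_fun measurableSet_Ioi fun x hx => ?_
  have hx : 0 < x := hx
  have : x ^ (a + 1 - 1) = x ^ (a - 1) * x := by
    rw [← Real.rpow_add_one hx.ne']; ring_nf
  simp only [this]
  ring

theorem integral_sq_mul_gammaMeasure {a : ℝ} (ha : 0 < a) (f : ℝ → ℝ) :
    ∫ x, x ^ 2 * f x ∂gammaMeasure a 1 = a * (a + 1) * ∫ x, f x ∂gammaMeasure (a + 2) 1 := by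
  simp only [pow_two, mul_assoc]
  rw [integral_mul_gammaMeasure ha, integral_mul_gammaMeasure (by linarith)]
  ring_nf

theorem mgf_gammaMeasure {a t : ℝ} (ha : 0 < a) (ht : t < 1) :
    mgf id (gammaMeasure a 1) t = (1 / (1 - t)) ^ a := by
  rw [mgf, integral_gammaMeasure ha]
  have : ∀ x : ℝ, x ^ (a - 1) * Real.exp (-x) * Real.exp (t * id x) =
      x ^ (a - 1) * Real.exp (-((1 - t) * x)) := fun x => by
    rw [mul_assoc, ← Real.exp_add]; simp only [id]; ring_nf
  simp only [this]
  rw [Real.integral_rpow_mul_exp_neg_mul_Ioi ha (by linarith)]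
  field_simp [(Real.Gamma_pos_of_pos ha).ne']

theorem not_integrable_exp_gammaMeasure {a t : ℝ} (ha : 0 < a) (ht : 1 ≤ t) :
    ¬ Integrable (fun x => Real.exp (t * x)) (gammaMeasure a 1) := by
  rw [integrable_gammaMeasure_iff ha]
  intro h
  refine not_integrableOn_Ioi_rpow (a - 1) (Integrable.mono' h (by fun_prop) ?_)
  filter_upwards [ae_restrict_mem measurableSet_Ioi] with x hx
  have hx : 0 < x := hx
  have h0 := Real.rpow_nonneg hx.le (a - 1)
  rw [Real.norm_of_nonneg h0, mul_assoc, ← Real.exp_add]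
  refine le_mul_of_one_le_right h0 (Real.one_le_exp ?_)
  nlinarith

theorem integrable_exp_gammaMeasure {a t : ℝ} (ha : 0 < a) (ht : t < 1) :
    Integrable (fun x => Real.exp (t * x)) (gammaMeasure a 1) := by
  have h : mgf id (gammaMeasure a 1) t ≠ 0 := by
    rw [mgf_gammaMeasure ha ht]
    exact (Real.rpow_pos_of_pos (by simpa using ht) _).ne'
  by_contra h'
  exact h (integral_undef h')

instance isProbabilityMeasure_gammaLaw (a : ℝ) : IsProbabilityMeasure (gammaLaw a) := by
  unfold gammaLaw
  split_ifs with h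
  · exact isProbabilityMeasure_gammaMeasure h one_pos
  · infer_instance

theorem gammaLaw_of_pos {a : ℝ} (ha : 0 < a) : gammaLaw a = gammaMeasure a 1 := if_pos ha

theorem gammaLaw_zero : gammaLaw 0 = Measure.dirac 0 := if_neg (lt_irrefl _)

/-- Two probability measures on `ℝ` with the same moment-generating function, finite near `0`,
coincide: their characteristic functions are values of the same analytic function. -/
theorem ext_of_mgf_eq {μ ν : Measure ℝ} [IsProbabilityMeasure μ] [IsProbabilityMeasure ν]
    (h0 : 0 ∈ interior (integrableExpSet id μ)) (h : mgf id μ = mgf id ν) : μ = ν := by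
  refine Measure.ext_of_charFun (funext fun t => ?_)
  rw [← complexMGF_id_mul_I, ← complexMGF_id_mul_I]
  exact eqOn_complexMGF_of_mgf h (by simpa using h0)

/-- Independent Gamma variables with a common rate add up to a Gamma variable. -/
theorem gammaLaw_conv {a b : ℝ} (ha : 0 ≤ a) (hb : 0 ≤ b) :
    (gammaLaw a).conv (gammaLaw b) = gammaLaw (a + b) := by
  rcases ha.eq_or_lt with rfl | ha
  · rw [gammaLaw_zero, Measure.dirac_zero_conv, zero_add]
  rcases hb.eq_or_lt with rfl | hb
  · rw [gammaLaw_zero, Measure.conv_dirac_zero, add_zero]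
  symm
  refine ext_of_mgf_eq ?_ ?_
  · rw [gammaLaw_of_pos (by linarith)]
    refine interior_mono (s := Set.Iio 1) (fun t ht => ?_) (by simp)
    exact integrable_exp_gammaMeasure (by linarith) ht
  · ext t
    have hm : mgf id ((gammaLaw a).conv (gammaLaw b)) t =
        mgf id (gammaLaw a) t * mgf id (gammaLaw b) t := by
      rw [Measure.conv, mgf_id_map (by fun_prop)]
      have := (indepFun_prod (μ := gammaLaw a) (ν := gammaLaw b) (X := id) (Y := id)
        measurable_id measurable_id).mgf_add' (t := t) (by fun_prop) (by fun_prop)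
      have h1 : mgf (fun ω : ℝ × ℝ => id ω.1) ((gammaLaw a).prod (gammaLaw b)) t =
          mgf id (gammaLaw a) t := by
        simp only [mgf]
        exact integral_fun_fst (fun x : ℝ => Real.exp (t * x)) |>.trans (by simp)
      have h2 : mgf (fun ω : ℝ × ℝ => id ω.2) ((gammaLaw a).prod (gammaLaw b)) t =
          mgf id (gammaLaw b) t := by
        simp only [mgf]
        exact integral_fun_snd (fun x : ℝ => Real.exp (t * x)) |>.trans (by simp)
      rw [h1, h2] at this
      exact this
    rw [hm, gammaLaw_of_pos ha, gammaLaw_of_pos hb, gammaLaw_of_pos (by linarith)]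
    rcases lt_or_ge t 1 with ht | ht
    · rw [mgf_gammaMeasure ha ht, mgf_gammaMeasure hb ht, mgf_gammaMeasure (by linarith) ht,
        Real.rpow_add (by simpa using ht)]
    -- for `1 ≤ t` no exponential moment exists, and both sides are the junk value `0`
    · have h0 : ∀ {r : ℝ}, 0 < r → mgf id (gammaMeasure r 1) t = 0 := fun hr =>
        mgf_undef (not_integrable_exp_gammaMeasure hr ht)
      rw [h0 ha, h0 (by linarith), zero_mul]

theorem charFunDual_gammaLaw_sum {ι : Type*} (s : Finset ι) (a : ι → ℝ) (ha : ∀ i, 0 ≤ a i)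
    (L : StrongDual ℝ ℝ) :
    charFunDual (gammaLaw (∑ i ∈ s, a i)) L = ∏ i ∈ s, charFunDual (gammaLaw (a i)) L := by
  classical
  induction s using Finset.induction_on with
  | empty => simp [gammaLaw_zero]
  | insert i s hi ih =>
    rw [Finset.sum_insert hi, Finset.prod_insert hi, ← ih,
      ← gammaLaw_conv (ha i) (Finset.sum_nonneg fun j _ => ha j), charFunDual_conv]

/-! ### Lumping the coordinates of a Dirichlet vector -/

section Aggregate

variable {ι κ : Type*} [Fintype ι] [DecidableEq κ]

/-- The sums of the coordinates of `z` over the fibres of `φ`. -/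
def fiberSum (φ : ι → κ) (z : ι → ℝ) : κ → ℝ := fun k => ∑ i with φ i = k, z i

@[fun_prop]
theorem measurable_fiberSum (φ : ι → κ) : Measurable (fiberSum φ) := by
  unfold fiberSum
  fun_prop

theorem sum_fiberSum [Fintype κ] (φ : ι → κ) (z : ι → ℝ) : ∑ k, fiberSum φ z k = ∑ i, z i :=
  Finset.sum_fiberwise _ _ _

/-- Fibre sums of independent Gamma variables are again independent Gamma variables. Fibre summing is
a continuous linear map, so this can be read off from the joint characteristic function. -/
theorem map_fiberSum_pi_gammaLaw [Fintype κ] (φ : ι → κ) (a : ι → ℝ) (ha : ∀ i, 0 ≤ a i) :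
    (Measure.pi fun i => gammaLaw (a i)).map (fiberSum φ) =
      Measure.pi fun k => gammaLaw (fiberSum φ a k) := by
  classical
  let T : (ι → ℝ) →L[ℝ] (κ → ℝ) :=
    ContinuousLinearMap.pi fun k => ∑ i with φ i = k, ContinuousLinearMap.proj i
  have hT : fiberSum φ = T := by
    ext z k
    simp [T, fiberSum]
  have : IsProbabilityMeasure ((Measure.pi fun i => gammaLaw (a i)).map (fiberSum φ)) :=
    Measure.isProbabilityMeasure_map (by fun_prop)
  rw [← charFunDual_eq_pi_iff]
  intro L
  rw [hT, charFunDual_map, charFunDual_pi, ← Finset.prod_fiberwise _ φ]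
  refine Finset.prod_congr rfl fun k _ => ?_
  have hk : T a k = ∑ i with φ i = k, a i := by rw [← hT]; rfl
  rw [hk, charFunDual_gammaLaw_sum _ _ ha]
  refine Finset.prod_congr rfl fun i hi => ?_
  obtain rfl : φ i = k := by simpa using hi
  congr 1
  ext
  simp only [ContinuousLinearMap.comp_apply]
  congr 1
  ext k
  simp [T, Pi.single_apply, eq_comm]

/-- Summing the coordinates of a Dirichlet vector over blocks gives a Dirichlet vector. -/
theorem map_fiberSum_dirichlet [Fintype κ] (φ : ι → κ) (a : ι → ℝ) (ha : ∀ i, 0 ≤ a i) :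
    (dirichlet a).map (fiberSum φ) = dirichlet (fiberSum φ a) := by
  have h : ∀ {ι : Type _} [Fintype ι], Measurable fun (z : ι → ℝ) i => z i / ∑ j, z j := by
    intro ι _
    fun_prop
  rw [dirichlet, dirichlet, ← map_fiberSum_pi_gammaLaw φ a ha, Measure.map_map (by fun_prop) h,
    Measure.map_map (by fun_prop) (by fun_prop)]
  congr 1
  ext z k
  simp only [Function.comp_apply, sum_fiberSum]
  simp [fiberSum, Finset.sum_div]

end Aggregate

theorem ae_nonneg_gammaLaw (a : ℝ) : ∀ᵐ x ∂gammaLaw a, 0 ≤ x := by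
  unfold gammaLaw
  split_ifs with h
  · rw [gammaMeasure_eq_withDensity_Ioi]
    refine (withDensity_absolutelyContinuous _ _).ae_le ?_
    filter_upwards [ae_restrict_mem measurableSet_Ioi] with x hx using le_of_lt hx
  · simp

theorem ae_pos_gammaLaw {a : ℝ} (ha : 0 < a) : ∀ᵐ x ∂gammaLaw a, 0 < x := by
  rw [gammaLaw_of_pos ha, gammaMeasure_eq_withDensity_Ioi]
  exact (withDensity_absolutelyContinuous _ _).ae_le (ae_restrict_mem measurableSet_Ioi)

/-! ### Moments of the Dirichlet distribution -/

/-- Second moment of a ratio of independent Gamma variables. Size-biasing twice turns the numerator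
into a factor, and `E[T⁻²]` for the sum `T` is found by size-biasing backwards. -/
theorem integral_sq_div_add_sq_gammaLaw {p q : ℝ} (hp : 0 < p) (hq : 0 ≤ q) :
    ∫ z, (z.1 / (z.1 + z.2)) ^ 2 ∂(gammaLaw p).prod (gammaLaw q) =
      p * (p + 1) / ((p + q) * (p + q + 1)) := by
  have hpq : 0 < p + q := by linarith
  have hint : ∫ x, (x ^ 2)⁻¹ ∂gammaMeasure (p + q + 2) 1 = ((p + q) * (p + q + 1))⁻¹ := by
    have h := integral_sq_mul_gammaMeasure hpq fun x => (x ^ 2)⁻¹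
    have h1 : ∫ x, x ^ 2 * (x ^ 2)⁻¹ ∂gammaMeasure (p + q) 1 = 1 := by
      have : IsProbabilityMeasure (gammaMeasure (p + q) 1) :=
        isProbabilityMeasure_gammaMeasure hpq one_pos
      have hae : (fun x : ℝ => x ^ 2 * (x ^ 2)⁻¹) =ᵐ[gammaMeasure (p + q) 1] fun _ => 1 := by
        have := ae_pos_gammaLaw hpq
        rw [gammaLaw_of_pos hpq] at this
        filter_upwards [this] with x hx
        exact mul_inv_cancel₀ (by positivity)
      rw [integral_congr_ae hae]
      simp
    rw [h1] at h
    exact eq_inv_of_mul_eq_one_right h.symm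
  have hmap : ((gammaLaw (p + 2)).prod (gammaLaw q)).map (fun z => z.1 + z.2) =
      gammaMeasure (p + q + 2) 1 := by
    have := gammaLaw_conv (a := p + 2) (b := q) (by linarith) hq
    rw [Measure.conv, gammaLaw_of_pos (by linarith : 0 < p + 2 + q)] at this
    rw [this]
    ring_nf
  have hi : Integrable (fun z : ℝ × ℝ => ((z.1 + z.2) ^ 2)⁻¹)
      ((gammaLaw (p + 2)).prod (gammaLaw q)) := by
    have : Integrable (fun x : ℝ => (x ^ 2)⁻¹) (gammaMeasure (p + q + 2) 1) := by
      by_contra h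
      rw [integral_undef h] at hint
      have : 0 < ((p + q) * (p + q + 1))⁻¹ := by positivity
      linarith
    rw [← hmap] at this
    exact this.comp_measurable (by fun_prop)
  have hi' : Integrable (fun z : ℝ × ℝ => (z.1 / (z.1 + z.2)) ^ 2)
      ((gammaLaw p).prod (gammaLaw q)) := by
    refine Integrable.of_bound (C := 1) (Measurable.aestronglyMeasurable (by fun_prop)) ?_
    have h1 := Measure.quasiMeasurePreserving_fst (μ := gammaLaw p) (ν := gammaLaw q)
      |>.ae (ae_nonneg_gammaLaw p)
    have h2 := Measure.quasiMeasurePreserving_snd (μ := gammaLaw p) (ν := gammaLaw q)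
      |>.ae (ae_nonneg_gammaLaw q)
    filter_upwards [h1, h2] with z h1 h2
    rw [Real.norm_of_nonneg (by positivity)]
    exact pow_le_one₀ (by positivity) (div_le_one_of_le₀ (by linarith) (by linarith))
  rw [integral_prod_symm _ hi']
  have hin : ∀ y : ℝ, ∫ x, (x / (x + y)) ^ 2 ∂gammaLaw p =
      p * (p + 1) * ∫ x, ((x + y) ^ 2)⁻¹ ∂gammaLaw (p + 2) := fun y => by
    rw [gammaLaw_of_pos hp, gammaLaw_of_pos (by linarith), ← integral_sq_mul_gammaMeasure hp]
    simp only [div_pow]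
    rfl
  simp only [hin]
  rw [integral_const_mul, ← integral_prod_symm _ hi,
    ← integral_map (f := fun x : ℝ => (x ^ 2)⁻¹) (φ := fun z : ℝ × ℝ => z.1 + z.2)
      (by fun_prop) (by fun_prop), hmap, hint, div_eq_mul_inv]

section Dirichlet

variable {ι : Type*} [Fintype ι]

instance (a : ι → ℝ) : IsProbabilityMeasure (dirichlet a) :=
  Measure.isProbabilityMeasure_map (by fun_prop)

theorem ae_nonneg_dirichlet (a : ι → ℝ) : ∀ᵐ w ∂dirichlet a, ∀ i, 0 ≤ w i := by
  rw [dirichlet, ae_map_iff (by fun_prop) (by measurability)]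
  have : ∀ᵐ z ∂Measure.pi fun i => gammaLaw (a i), ∀ i, 0 ≤ z i := by
    rw [ae_all_iff]
    exact fun i => (Measure.quasiMeasurePreserving_eval _ _).ae (ae_nonneg_gammaLaw (a i))
  filter_upwards [this] with z hz i
  exact div_nonneg (hz i) (Finset.sum_nonneg fun j _ => hz j)

theorem ae_sum_eq_one_dirichlet {a : ι → ℝ} {i : ι} (hi : 0 < a i) :
    ∀ᵐ w ∂dirichlet a, ∑ i, w i = 1 := by
  rw [dirichlet, ae_map_iff (by fun_prop) (measurableSet_eq_fun (by fun_prop) (by fun_prop))]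
  have h1 : ∀ᵐ z ∂Measure.pi fun i => gammaLaw (a i), ∀ i, 0 ≤ z i := by
    rw [ae_all_iff]
    exact fun i => (Measure.quasiMeasurePreserving_eval _ _).ae (ae_nonneg_gammaLaw (a i))
  have h2 : ∀ᵐ z ∂Measure.pi fun i => gammaLaw (a i), 0 < z i :=
    (Measure.quasiMeasurePreserving_eval _ _).ae (ae_pos_gammaLaw hi)
  filter_upwards [h1, h2] with z h1 h2
  rw [← Finset.sum_div]
  exact div_self (h2.trans_le (Finset.single_le_sum (fun j _ => h1 j) (Finset.mem_univ i))).ne'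

/-- The total weight of a block of a Dirichlet vector has a Beta distribution, whose second moment
this is. -/
theorem integral_sq_sum_dirichlet {a : ι → ℝ} (ha : ∀ i, 0 ≤ a i) (T : Finset ι)
    (hT : 0 < ∑ i ∈ T, a i) :
    ∫ w, (∑ i ∈ T, w i) ^ 2 ∂dirichlet a =
      (∑ i ∈ T, a i) * (∑ i ∈ T, a i + 1) / ((∑ i, a i) * (∑ i, a i + 1)) := by
  classical
  let φ : ι → Fin 2 := fun i => if i ∈ T then 0 else 1
  have h0 : ∀ w : ι → ℝ, fiberSum φ w 0 = ∑ i ∈ T, w i := fun w => by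
    refine Finset.sum_congr ?_ fun _ _ => rfl
    ext i
    by_cases h : i ∈ T <;> simp [φ, h]
  have hs : fiberSum φ a 0 + fiberSum φ a 1 = ∑ i, a i := by
    rw [← sum_fiberSum φ a, Fin.sum_univ_two]
  have h1 : 0 ≤ fiberSum φ a 1 := Finset.sum_nonneg fun i _ => ha i
  have key := integral_sq_div_add_sq_gammaLaw (p := fiberSum φ a 0) (by rwa [h0]) h1
  rw [hs, h0] at key
  rw [← key, ← h0 a]
  simp only [← h0]
  rw [← integral_map (f := fun v : Fin 2 → ℝ => v 0 ^ 2) (φ := fiberSum φ) (by fun_prop)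
      (Measurable.aestronglyMeasurable (by fun_prop)), map_fiberSum_dirichlet φ a ha, dirichlet,
    integral_map (by fun_prop) (Measurable.aestronglyMeasurable (by fun_prop)),
    ← (measurePreserving_piFinTwo fun k => gammaLaw (fiberSum φ a k)).integral_comp
      (MeasurableEquiv.measurableEmbedding _)]
  simp [MeasurableEquiv.piFinTwo]

theorem integrable_mul_dirichlet (a : ι → ℝ) {i₀ : ι} (h₀ : 0 < a i₀) (i j : ι) :
    Integrable (fun w => w i * w j) (dirichlet a) := by
  refine Integrable.of_bound (C := 1) (by fun_prop) ?_
  filter_upwards [ae_nonneg_dirichlet a, ae_sum_eq_one_dirichlet h₀] with w hw hs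
  have hle : ∀ i, w i ≤ 1 := fun i =>
    hs ▸ Finset.single_le_sum (fun j _ => hw j) (Finset.mem_univ i)
  rw [Real.norm_of_nonneg (mul_nonneg (hw i) (hw j))]
  exact mul_le_one₀ (hle i) (hw j) (hle j)

end Dirichlet

instance (s : ℝ) (n : ℕ) : IsProbabilityMeasure (weightLaw s n) :=
  inferInstanceAs (IsProbabilityMeasure (dirichlet _))

theorem secondMoment_apply {s : ℝ} (hs : 0 < s) (n : ℕ) (j k : Fin n) :
    secondMoment s n j k = (s + n)⁻¹ * (s + n + 1)⁻¹ * (1 + if j = k then 1 else 0) := by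
  have ha : ∀ i : Fin (n + 1), 0 ≤ (Fin.cons s fun _ => 1 : Fin (n + 1) → ℝ) i :=
    Fin.cases hs.le fun _ => zero_le_one
  have hA : ∑ i, (Fin.cons s fun _ => 1 : Fin (n + 1) → ℝ) i = s + n := by
    simp [Fin.sum_univ_succ]
  have hsn : 0 < s + n := by positivity
  have sq : ∀ j : Fin n, ∫ w, w j.succ ^ 2 ∂weightLaw s n = 2 * ((s + n) * (s + n + 1))⁻¹ :=
    fun j => by
      have := integral_sq_sum_dirichlet ha {j.succ} (by simp)
      rw [hA] at this
      simp only [Finset.sum_singleton, Fin.cons_succ] at this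
      rw [weightLaw, this]
      ring
  simp only [secondMoment, of_apply]
  rcases eq_or_ne j k with rfl | hjk
  · simp only [← pow_two, sq, if_true]
    rw [mul_inv]
    ring
  -- polarisation: the weight `w j + w k` of a block of two is known to second order
  · have h2 := integral_sq_sum_dirichlet ha {j.succ, k.succ} (by simp [hjk])
    rw [hA] at h2
    simp only [Finset.sum_pair ((Fin.succ_injective n).ne hjk), Fin.cons_succ] at h2
    have hi := integrable_mul_dirichlet (Fin.cons s fun _ => 1 : Fin (n + 1) → ℝ) (i₀ := 0) hs
    have hexp : ∀ w : Fin (n + 1) → ℝ, (w j.succ + w k.succ) ^ 2 =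
        w j.succ * w j.succ + (2 * (w j.succ * w k.succ) + w k.succ * w k.succ) := fun w => by ring
    simp only [hexp] at h2
    have hi2 := (hi j.succ k.succ).const_mul 2
    rw [integral_add (hi _ _) (by exact hi2.add (hi _ _)), integral_add hi2 (hi _ _),
      integral_const_mul] at h2
    have hj := sq j
    have hk := sq k
    simp only [pow_two] at hj hk
    rw [weightLaw] at hj hk ⊢
    rw [hj, hk] at h2
    rw [if_neg hjk, ← mul_inv]
    rw [div_eq_mul_inv] at h2
    linarith

/-! ### The statistic and Dirichlet processes as measurable objects -/

theorem measurable_real_eval {B : Set ℝ} (hB : MeasurableSet B) :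
    Measurable fun P : ProbabilityMeasure ℝ => (P : Measure ℝ).real B :=
  ((Measure.measurable_coe hB).comp measurable_subtype_coe).ennreal_toReal

theorem IsDirichletProcess.isProbabilityMeasure {α : Measure ℝ}
    {Q : Measure (ProbabilityMeasure ℝ)} (h : IsDirichletProcess α Q) : IsProbabilityMeasure Q := by
  have h1 := h 1 (fun _ => Set.univ) (fun _ => .univ)
    (fun i j hij => (hij (Subsingleton.elim i j)).elim) (Set.iUnion_const _)
  have hm : Measurable fun (P : ProbabilityMeasure ℝ) (_ : Fin 1) =>
      (P : Measure ℝ).real Set.univ :=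
    measurable_pi_lambda _ fun _ => measurable_real_eval .univ
  constructor
  rw [← Set.preimage_univ (f := fun (P : ProbabilityMeasure ℝ) (_ : Fin 1) =>
    (P : Measure ℝ).real Set.univ), ← Measure.map_apply hm .univ, h1, measure_univ]

theorem measurable_g {n₁ n₂ : ℕ} (x : Fin n₁ → ℝ) (y : Fin n₂ → ℝ) : Measurable (g x y) := by
  unfold g
  fun_prop

theorem measurable_probLE : Measurable probLE := by
  have h : Measurable fun F : ProbabilityMeasure ℝ × ProbabilityMeasure ℝ =>
      (F.1 : Measure ℝ).prod (F.2 : Measure ℝ) := by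
    refine Measurable.measure_of_isPiSystem_of_isProbabilityMeasure
      generateFrom_prod.symm isPiSystem_prod ?_
    rintro _ ⟨u, hu, v, hv, rfl⟩
    have hu' : MeasurableSet u := hu
    have hv' : MeasurableSet v := hv
    simp only [Measure.prod_prod]
    exact ((Measure.measurable_coe hu').comp (measurable_subtype_coe.comp measurable_fst)).mul
      ((Measure.measurable_coe hv').comp (measurable_subtype_coe.comp measurable_snd))
  exact ((Measure.measurable_coe (measurableSet_le measurable_fst measurable_snd)).comp
    h).ennreal_toReal

theorem updatedBase_real {s : ℝ} (hs : 0 ≤ s) (G : ProbabilityMeasure ℝ) {n : ℕ} (x : Fin n → ℝ)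
    {B : Set ℝ} (hB : MeasurableSet B) :
    (updatedBase s G x).real B = s * (G : Measure ℝ).real B + ∑ j, B.indicator 1 (x j) := by
  have h1 : ∀ j, Measure.dirac (x j) B = ENNReal.ofReal (B.indicator 1 (x j)) := fun j => by
    by_cases h : x j ∈ B <;> simp [Measure.dirac_apply' _ hB, h]
  have h2 : ∀ j, (0 : ℝ) ≤ B.indicator 1 (x j) := fun j =>
    Set.indicator_nonneg (fun _ _ => zero_le_one) _
  rw [measureReal_def, updatedBase, Measure.add_apply, Measure.smul_apply,
    Measure.finsetSum_apply, Finset.sum_congr rfl fun j _ => h1 j,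
    ← ENNReal.ofReal_sum_of_nonneg fun j _ => h2 j, smul_eq_mul,
    ENNReal.toReal_add (ENNReal.mul_ne_top ENNReal.ofReal_ne_top (measure_ne_top _ _))
      ENNReal.ofReal_ne_top, ENNReal.toReal_mul, ENNReal.toReal_ofReal hs,
    ENNReal.toReal_ofReal (Finset.sum_nonneg fun j _ => h2 j), measureReal_def]

/-! ### The partition of the line induced by a sample -/

section Locate

variable {n : ℕ} (x : Fin n → ℝ)

open Classical in
/-- The block of the point `r` in the partition of `ℝ` induced by the sample `x`: an index `j + 1`
with `x j = r` (one fixed choice if there are several), and `0` if `r` is not a sample point. -/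
noncomputable def locate (r : ℝ) : Fin (n + 1) :=
  if h : ∃ j, x j = r then h.choose.succ else 0

variable {x}

theorem eq_of_locate_eq_succ {r : ℝ} {j : Fin n} (h : locate x r = j.succ) : x j = r := by
  unfold locate at h
  split_ifs at h with hr
  · rw [← Fin.succ_injective n h]
    exact hr.choose_spec
  · exact (Fin.succ_ne_zero j h.symm).elim

theorem exists_locate_eq_succ (j : Fin n) : ∃ i : Fin n, locate x (x j) = i.succ := by
  have h : ∃ i, x i = x j := ⟨j, rfl⟩
  exact ⟨h.choose, dif_pos h⟩

theorem measurable_locate : Measurable (locate x) := by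
  have hsucc : ∀ j : Fin n, MeasurableSet (locate x ⁻¹' {j.succ}) := fun j =>
    Set.Subsingleton.measurableSet fun r hr r' hr' =>
      (eq_of_locate_eq_succ hr).symm.trans (eq_of_locate_eq_succ hr')
  refine measurable_to_countable' fun k => ?_
  refine Fin.cases ?_ hsucc k
  have : locate x ⁻¹' {0} = (⋃ j : Fin n, locate x ⁻¹' {j.succ})ᶜ := by
    ext r
    simp only [Set.mem_preimage, Set.mem_singleton_iff, Set.mem_compl_iff, Set.mem_iUnion]
    refine Fin.cases (motive := fun k => k = 0 ↔ ¬ ∃ j : Fin n, k = j.succ) ?_ ?_ (locate x r)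
    · simp [eq_comm, Fin.succ_ne_zero]
    · intro i
      simp [Fin.succ_ne_zero]
  rw [this]
  exact (MeasurableSet.iUnion hsucc).compl

/-- The masses that `P` gives to the blocks of the partition of `ℝ` induced by the sample `x`. -/
noncomputable def blockMass (x : Fin n → ℝ) (P : ProbabilityMeasure ℝ) : Fin (n + 1) → ℝ :=
  fun k => (P : Measure ℝ).real (locate x ⁻¹' {k})

theorem measurable_blockMass : Measurable (blockMass x) :=
  measurable_pi_lambda _ fun _ => measurable_real_eval (measurable_locate (measurableSet_singleton _))

end Locate

/-- The pairs of sample points with `x j < y k` alone contribute this much to `P(X ≤ Y)`. With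
repeated sample points nothing is counted twice, since `blockMass` is `0` at all but one index of each
value. -/
theorem g_blockMass_le_probLE {n₁ n₂ : ℕ} (x : Fin n₁ → ℝ) (y : Fin n₂ → ℝ)
    (F : ProbabilityMeasure ℝ × ProbabilityMeasure ℝ) :
    g x y (blockMass x F.1, blockMass y F.2) ≤ probLE F := by
  classical
  let S : Finset (Fin n₁ × Fin n₂) := {p | x p.1 < y p.2}
  let E : Fin n₁ × Fin n₂ → Set (ℝ × ℝ) := fun p =>
    (locate x ⁻¹' {p.1.succ}) ×ˢ (locate y ⁻¹' {p.2.succ})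
  have hE : ∀ p, MeasurableSet (E p) := fun p =>
    (measurable_locate (measurableSet_singleton _)).prod
      (measurable_locate (measurableSet_singleton _))
  have hd : Set.PairwiseDisjoint (S : Set (Fin n₁ × Fin n₂)) E := by
    intro p _ q _ hpq
    refine Set.disjoint_left.2 fun r hp hq => hpq ?_
    simp only [E, Set.mem_prod, Set.mem_preimage, Set.mem_singleton_iff] at hp hq
    exact Prod.ext (Fin.succ_injective _ (hp.1.symm.trans hq.1))
      (Fin.succ_injective _ (hp.2.symm.trans hq.2))
  have hsub : ⋃ p ∈ S, E p ⊆ {p | p.1 ≤ p.2} := by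
    intro r hr
    simp only [Set.mem_iUnion] at hr
    obtain ⟨p, hp, hr⟩ := hr
    have h1 := eq_of_locate_eq_succ hr.1
    have h2 := eq_of_locate_eq_succ hr.2
    have hp : x p.1 < y p.2 := by simpa [S] using hp
    rw [h1, h2] at hp
    exact hp.le
  have hg : g x y (blockMass x F.1, blockMass y F.2) =
      ((F.1 : Measure ℝ).prod (F.2 : Measure ℝ)).real (⋃ p ∈ S, E p) := by
    rw [measureReal_biUnion_finset hd fun p _ => hE p, g, ← Finset.sum_product',
      Finset.univ_product_univ, Finset.sum_filter]
    refine Finset.sum_congr rfl fun p _ => ?_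
    rw [measureReal_prod_prod]
    simp [Set.indicator_apply, blockMass]
  rw [hg]
  exact measureReal_mono hsub

/-! ### The lower bound by a common refinement -/

theorem fiberSum_elim_id {ι κ : Type*} [Fintype ι] [Fintype κ] [DecidableEq κ] (ψ : ι → κ)
    (u : κ ⊕ ι → ℝ) (k : κ) :
    fiberSum (Sum.elim id ψ) u k = u (Sum.inl k) + ∑ i with ψ i = k, u (Sum.inr i) := by
  simp only [fiberSum, Finset.sum_filter, Fintype.sum_sum_type, Sum.elim_inr]
  congr 1
  exact (Finset.sum_ite_eq' Finset.univ k fun a => u (Sum.inl a)).trans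
    (if_pos (Finset.mem_univ k))

section Refinement

variable {n : ℕ} (x : Fin n → ℝ)

/-- The parameters of the common refinement of the Dirichlet vectors of the block masses and of the
weights: the prior base measure of each block, and a unit for each observation. -/
noncomputable def refinedParam (s : ℝ) (G : ProbabilityMeasure ℝ) : Fin (n + 1) ⊕ Fin n → ℝ :=
  Sum.elim (fun k => s * blockMass x G k) fun _ => 1

variable {x}

theorem refinedParam_nonneg {s : ℝ} (hs : 0 ≤ s) (G : ProbabilityMeasure ℝ) (i) :
    0 ≤ refinedParam x s G i := by
  rcases i with k | j
  · exact mul_nonneg hs measureReal_nonneg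
  · exact zero_le_one

theorem sum_blockMass (G : ProbabilityMeasure ℝ) : ∑ k, blockMass x G k = 1 := by
  have h := sum_measureReal_preimage_singleton (μ := (G : Measure ℝ)) (Finset.univ) (f := locate x)
    (fun k _ => measurable_locate (measurableSet_singleton k))
  simpa [blockMass] using h

/-- Adding the observations to the blocks that contain them gives the block masses. -/
theorem map_blockMass {s : ℝ} (hs : 0 ≤ s) {G : ProbabilityMeasure ℝ}
    {R : Measure (ProbabilityMeasure ℝ)} (hR : IsDirichletProcess (updatedBase s G x) R) :
    R.map (blockMass x) = (dirichlet (refinedParam x s G)).map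
      (fiberSum (Sum.elim id fun j => locate x (x j))) := by
  rw [map_fiberSum_dirichlet _ _ (refinedParam_nonneg hs G)]
  have h := hR (n + 1) (fun k => locate x ⁻¹' {k})
    (fun k => measurable_locate (measurableSet_singleton k))
    (fun i j hij => Disjoint.preimage _ (by simpa using hij))
    (by ext; simp)
  refine h.trans ?_
  congr 1
  ext k
  have hm : MeasurableSet (locate x ⁻¹' {k}) := measurable_locate (measurableSet_singleton k)
  rw [updatedBase_real hs G x hm]
  rw [fiberSum_elim_id]
  simp [refinedParam, blockMass, Set.indicator]

/-- Lumping the whole prior mass together gives the weights. -/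
theorem weightLaw_eq_map {s : ℝ} (hs : 0 ≤ s) (G : ProbabilityMeasure ℝ) :
    weightLaw s n = (dirichlet (refinedParam x s G)).map
      (fiberSum (Sum.elim (fun _ => 0) Fin.succ)) := by
  rw [map_fiberSum_dirichlet _ _ (refinedParam_nonneg hs G), weightLaw]
  congr 1
  ext k
  simp only [fiberSum, Finset.sum_filter, Fintype.sum_sum_type, Sum.elim_inl, Sum.elim_inr,
    refinedParam]
  refine Fin.cases ?_ (fun j => ?_) k
  · simp [← Finset.mul_sum, sum_blockMass, Fin.succ_ne_zero]
  · simp [(Fin.succ_ne_zero j).symm]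

end Refinement

/-- Every block keeps the weights of the observations that it contains and gains its share of the
prior mass, which can only increase `g`. -/
theorem g_fiberSum_le {n₁ n₂ : ℕ} (x : Fin n₁ → ℝ) (y : Fin n₂ → ℝ)
    (u : Fin (n₁ + 1) ⊕ Fin n₁ → ℝ) (v : Fin (n₂ + 1) ⊕ Fin n₂ → ℝ)
    (hu : ∀ i, 0 ≤ u i) (hv : ∀ i, 0 ≤ v i) :
    g x y (fiberSum (Sum.elim (fun _ => 0) Fin.succ) u,
        fiberSum (Sum.elim (fun _ => 0) Fin.succ) v) ≤
      g x y (fiberSum (Sum.elim id fun j => locate x (x j)) u,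
        fiberSum (Sum.elim id fun k => locate y (y k)) v) := by
  -- `σ j` and `τ k` are the chosen representatives of the values `x j` and `y k`
  choose σ hσ using exists_locate_eq_succ (x := x)
  choose τ hτ using exists_locate_eq_succ (x := y)
  have hxσ : ∀ j, x (σ j) = x j := fun j => eq_of_locate_eq_succ (hσ j)
  have hyτ : ∀ k, y (τ k) = y k := fun k => eq_of_locate_eq_succ (hτ k)
  have hw : ∀ {n : ℕ} (u : Fin (n + 1) ⊕ Fin n → ℝ) (j : Fin n),
      fiberSum (Sum.elim (fun _ => 0) Fin.succ) u j.succ = u (Sum.inr j) := fun u j => by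
    simp [fiberSum, Finset.sum_filter, Fintype.sum_sum_type, (Fin.succ_ne_zero j).symm]
  have hb : ∀ {n : ℕ} {x : Fin n → ℝ} {σ : Fin n → Fin n} (_ : ∀ j, locate x (x j) = (σ j).succ)
      (u : Fin (n + 1) ⊕ Fin n → ℝ) (_ : ∀ i, 0 ≤ u i) (i : Fin n),
      (∑ j with σ j = i, u (Sum.inr j)) ≤
        fiberSum (Sum.elim id fun j => locate x (x j)) u i.succ := fun hσ u hu i => by
    rw [fiberSum_elim_id]
    simp only [hσ, Fin.succ_inj]
    exact le_add_of_nonneg_left (hu _)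
  calc
    _ = ∑ j, ∑ k, u (Sum.inr j) * v (Sum.inr k) *
          (Set.Ioi (x (σ j))).indicator (fun _ => 1) (y (τ k)) := by
        simp only [g, hw, hxσ, hyτ]
    _ = ∑ i, ∑ l, (∑ j with σ j = i, u (Sum.inr j)) * (∑ k with τ k = l, v (Sum.inr k)) *
          (Set.Ioi (x i)).indicator (fun _ => 1) (y l) := by
        rw [← Finset.sum_fiberwise _ σ]
        refine Finset.sum_congr rfl fun i _ => ?_
        have : ∀ j ∈ Finset.univ.filter (fun j => σ j = i), (∑ k, u (Sum.inr j) * v (Sum.inr k) *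
            (Set.Ioi (x (σ j))).indicator (fun _ => (1 : ℝ)) (y (τ k))) =
            ∑ l, u (Sum.inr j) * (∑ k with τ k = l, v (Sum.inr k)) *
              (Set.Ioi (x i)).indicator (fun _ => 1) (y l) := fun j hj => by
          rw [← Finset.sum_fiberwise _ τ]
          refine Finset.sum_congr rfl fun l _ => ?_
          rw [Finset.mul_sum, Finset.sum_mul]
          refine Finset.sum_congr rfl fun k hk => ?_
          rw [(Finset.mem_filter.1 hj).2, (Finset.mem_filter.1 hk).2]
        rw [Finset.sum_congr rfl this, Finset.sum_comm]
        simp only [Finset.sum_mul]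
    _ ≤ _ := by
        unfold g
        refine Finset.sum_le_sum fun i _ => Finset.sum_le_sum fun l _ => ?_
        refine mul_le_mul_of_nonneg_right (mul_le_mul (hb hσ u hu i) (hb hτ v hv l)
          (Finset.sum_nonneg fun _ _ => hv _)
          ((Finset.sum_nonneg fun _ _ => hu _).trans (hb hσ u hu i)))
          (Set.indicator_nonneg (fun _ _ => zero_le_one) _)

/-- The posterior probability is bounded below uniformly in the prior base measures. -/
theorem le_posterior_prob {s : ℝ} (hs : 0 ≤ s) (c : ℝ) {n₁ n₂ : ℕ} (x : Fin n₁ → ℝ)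
    (y : Fin n₂ → ℝ) {G₁ G₂ : ProbabilityMeasure ℝ} {R₁ R₂ : Measure (ProbabilityMeasure ℝ)}
    (h₁ : IsDirichletProcess (updatedBase s G₁ x) R₁)
    (h₂ : IsDirichletProcess (updatedBase s G₂ y) R₂) :
    ((weightLaw s n₁).prod (weightLaw s n₂)).real {w | c < g x y w} ≤
      (R₁.prod R₂).real {F | c < probLE F} := by
  have := h₁.isProbabilityMeasure
  have := h₂.isProbabilityMeasure
  have hg : MeasurableSet {w | c < g x y w} := measurableSet_lt measurable_const (measurable_g x y)
  set D₁ := dirichlet (refinedParam x s G₁)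
  set D₂ := dirichlet (refinedParam y s G₂)
  refine ENNReal.toReal_mono (measure_ne_top _ _) ?_
  calc ((weightLaw s n₁).prod (weightLaw s n₂)) {w | c < g x y w}
      = (D₁.prod D₂) {p | c < g x y (fiberSum (Sum.elim (fun _ => 0) Fin.succ) p.1,
          fiberSum (Sum.elim (fun _ => 0) Fin.succ) p.2)} := by
        rw [weightLaw_eq_map hs G₁ (x := x), weightLaw_eq_map hs G₂ (x := y),
          Measure.map_prod_map _ _ (by fun_prop) (by fun_prop),
          Measure.map_apply (by fun_prop) hg]
        rfl
    _ ≤ (D₁.prod D₂) {p | c < g x y (fiberSum (Sum.elim id fun j => locate x (x j)) p.1,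
          fiberSum (Sum.elim id fun k => locate y (y k)) p.2)} := by
        refine measure_mono_ae ?_
        have hu := Measure.quasiMeasurePreserving_fst (μ := D₁) (ν := D₂)
          |>.ae (ae_nonneg_dirichlet (refinedParam x s G₁))
        have hv := Measure.quasiMeasurePreserving_snd (μ := D₁) (ν := D₂)
          |>.ae (ae_nonneg_dirichlet (refinedParam y s G₂))
        filter_upwards [hu, hv] with p hu hv hp
        exact lt_of_lt_of_le hp (g_fiberSum_le x y p.1 p.2 hu hv)
    _ = (R₁.prod R₂) {F | c < g x y (blockMass x F.1, blockMass y F.2)} := by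
        have hR : (R₁.prod R₂).map (Prod.map (blockMass x) (blockMass y)) =
            (D₁.prod D₂).map (Prod.map (fiberSum (Sum.elim id fun j => locate x (x j)))
              (fiberSum (Sum.elim id fun k => locate y (y k)))) := by
          rw [← Measure.map_prod_map _ _ measurable_blockMass measurable_blockMass,
            ← Measure.map_prod_map _ _ (by fun_prop) (by fun_prop), map_blockMass hs h₁,
            map_blockMass hs h₂]
        have := congrArg (fun μ => μ {w | c < g x y w}) hR
        beta_reduce at this
        rw [Measure.map_apply (measurable_blockMass.prodMap measurable_blockMass) hg,
          Measure.map_apply (by fun_prop) hg] at this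
        exact this.symm
    _ ≤ (R₁.prod R₂) {F | c < probLE F} :=
        measure_mono fun F hF => lt_of_lt_of_le hF (g_blockMass_le_probLE x y F)

/-! ### Dirichlet processes with a degenerate prior base measure -/

section Mixture

variable {n : ℕ}

/-- The discrete measure with mass `q.1 i` at the atom `q.2 i`; negative masses are read as `0`. -/
noncomputable def atomicMeasure (q : (Fin (n + 1) → ℝ) × (Fin (n + 1) → ℝ)) : Measure ℝ :=
  ∑ i, ENNReal.ofReal (q.1 i) • Measure.dirac (q.2 i)

theorem measurable_atomicMeasure : Measurable (atomicMeasure (n := n)) := by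
  refine Measure.measurable_of_measurable_coe _ fun B hB => ?_
  simp only [atomicMeasure, Measure.finsetSum_apply, Measure.smul_apply, smul_eq_mul]
  refine Finset.measurable_sum _ fun i _ => Measurable.mul (by fun_prop) ?_
  exact (Measure.measurable_coe hB).comp (Measure.measurable_dirac.comp (by fun_prop))

theorem isProbabilityMeasure_atomicMeasure {w p : Fin (n + 1) → ℝ} (hw : ∀ i, 0 ≤ w i)
    (h1 : ∑ i, w i = 1) : IsProbabilityMeasure (atomicMeasure (w, p)) := by
  constructor
  simp [atomicMeasure, ← ENNReal.ofReal_sum_of_nonneg fun i _ => hw i, h1]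

open Classical in
/-- The random probability measure with weights `q.1` and atoms `q.2`; where the weights do not lie
in the simplex, it is given the arbitrary value `δ₀`. -/
noncomputable def atomic (q : (Fin (n + 1) → ℝ) × (Fin (n + 1) → ℝ)) : ProbabilityMeasure ℝ :=
  ⟨if IsProbabilityMeasure (atomicMeasure q) then atomicMeasure q else Measure.dirac 0, by
    split_ifs with h
    · exact h
    · infer_instance⟩

theorem measurable_atomic : Measurable (atomic (n := n)) := by
  classical
  refine Measurable.subtype_mk (Measurable.ite ?_ measurable_atomicMeasure measurable_const)
  exact measurable_atomicMeasure ProbabilityMeasure.measurableSet_isProbabilityMeasure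

theorem measurable_atomic_weights (p : Fin (n + 1) → ℝ) : Measurable fun w => atomic (w, p) :=
  measurable_atomic.comp (measurable_id.prodMk measurable_const)

theorem coe_atomic {w p : Fin (n + 1) → ℝ} (hw : ∀ i, 0 ≤ w i) (h1 : ∑ i, w i = 1) :
    (atomic (w, p) : Measure ℝ) = atomicMeasure (w, p) :=
  if_pos (isProbabilityMeasure_atomicMeasure hw h1)

/-- The law of the random probability measure that has the atoms `M, x 1, …, x n` and weights with
distribution `Dir(s, 1, …, 1)`, as a kernel in the sample `x`. -/
noncomputable def atomicKernel (s M : ℝ) (n : ℕ) : Kernel (Fin n → ℝ) (ProbabilityMeasure ℝ) :=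
  (Kernel.id ×ₖ Kernel.const _ (weightLaw s n)).map
    fun q => atomic (q.2, (Fin.cons M q.1 : Fin (n + 1) → ℝ))

theorem measurable_cons (M : ℝ) :
    Measurable fun x : Fin n → ℝ => (Fin.cons M x : Fin (n + 1) → ℝ) :=
  measurable_pi_lambda _ (Fin.cases measurable_const fun j => measurable_pi_apply j)

theorem measurable_atomic_cons (M : ℝ) :
    Measurable fun q : (Fin n → ℝ) × (Fin (n + 1) → ℝ) =>
      atomic (q.2, (Fin.cons M q.1 : Fin (n + 1) → ℝ)) :=
  measurable_atomic.comp (measurable_snd.prodMk ((measurable_cons M).comp measurable_fst))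

instance (s M : ℝ) (n : ℕ) : IsMarkovKernel (atomicKernel s M n) :=
  Kernel.IsMarkovKernel.map _ (measurable_atomic_cons M)

theorem atomicKernel_apply (s M : ℝ) (x : Fin n → ℝ) :
    atomicKernel s M n x =
      (weightLaw s n).map fun w => atomic (w, (Fin.cons M x : Fin (n + 1) → ℝ)) := by
  rw [atomicKernel, Kernel.map_apply _ (measurable_atomic_cons M), Kernel.prod_apply,
    Kernel.id_apply, Kernel.const_apply, Measure.dirac_prod,
    Measure.map_map (measurable_atomic_cons M) measurable_prodMk_left]
  rfl

theorem ae_simplex_weightLaw {s : ℝ} (hs : 0 < s) (n : ℕ) :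
    ∀ᵐ w ∂weightLaw s n, (∀ i, 0 ≤ w i) ∧ ∑ i, w i = 1 :=
  (ae_nonneg_dirichlet _).and (ae_sum_eq_one_dirichlet (i := 0) hs)

/-- The point mass at `M`, as a probability measure. -/
noncomputable def pointMass (M : ℝ) : ProbabilityMeasure ℝ := ⟨Measure.dirac M, inferInstance⟩

/-- If the normalised base measure is a point mass, the updated base measure has finitely many
atoms, and the Dirichlet process is a random weighting of these atoms. -/
theorem isDirichletProcess_atomicKernel {s : ℝ} (hs : 0 < s) (M : ℝ) (x : Fin n → ℝ) :
    IsDirichletProcess (updatedBase s (pointMass M) x) (atomicKernel s M n x) := by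
  classical
  intro m B hB hdisj hcov
  set p : Fin (n + 1) → ℝ := Fin.cons M x with hp
  have hex : ∀ r : ℝ, ∃ k, r ∈ B k := fun r => by
    simpa using (hcov ▸ Set.mem_univ r : r ∈ ⋃ i, B i)
  -- `φ r` is the block of the partition that contains `r`
  choose φ hφ using hex
  have hmem : ∀ r k, r ∈ B k ↔ φ r = k := fun r k => by
    constructor
    · intro h
      by_contra hne
      exact Set.disjoint_left.1 (hdisj hne) (hφ r) h
    · rintro rfl
      exact hφ r
  rw [atomicKernel_apply, Measure.map_map
    (measurable_pi_lambda _ fun k => measurable_real_eval (hB k)) (measurable_atomic_weights _)]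
  have hae : ((fun (P : ProbabilityMeasure ℝ) k => (P : Measure ℝ).real (B k)) ∘
      fun w => atomic (w, p)) =ᵐ[weightLaw s n] fiberSum fun i => φ (p i) := by
    filter_upwards [ae_simplex_weightLaw hs n] with w ⟨hw, h1⟩
    ext k
    simp only [Function.comp_apply]
    rw [coe_atomic hw h1, measureReal_def, atomicMeasure, Measure.finsetSum_apply,
      ENNReal.toReal_sum fun i _ => by
        exact ENNReal.mul_ne_top ENNReal.ofReal_ne_top (measure_ne_top _ _),
      fiberSum, Finset.sum_filter]
    refine Finset.sum_congr rfl fun i _ => ?_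
    by_cases h : φ (p i) = k
    · simp [Measure.dirac_apply' _ (hB k), (hmem _ _).2 h, h, hw i]
    · have h' : p i ∉ B k := fun hb => h ((hmem _ _).1 hb)
      simp [Measure.dirac_apply' _ (hB k), h', h]
  rw [Measure.map_congr hae, weightLaw, map_fiberSum_dirichlet _ _
    (Fin.cases hs.le fun _ => zero_le_one)]
  congr 1
  ext k
  rw [updatedBase_real hs.le _ _ (hB k), fiberSum, Finset.sum_filter, Fin.sum_univ_succ]
  congr 1
  · by_cases h : φ M = k
    · simp [measureReal_def, pointMass, Measure.dirac_apply' _ (hB k), (hmem _ _).2 h, h, hp]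
    · have h' : M ∉ B k := fun hb => h ((hmem _ _).1 hb)
      simp [measureReal_def, pointMass, Measure.dirac_apply' _ (hB k), h', h, hp]
  · simp [Set.indicator_apply, hmem, hp]

/-- At constant data equal to the prior atom, all random weight sits at that atom. -/
theorem atomicKernel_const {s : ℝ} (hs : 0 < s) (M : ℝ) (n : ℕ) :
    atomicKernel s M n (fun _ => M) = Measure.dirac (pointMass M) := by
  have hae : (fun w => atomic (w, (Fin.cons M fun _ => M : Fin (n + 1) → ℝ))) =ᵐ[weightLaw s n]
      fun _ => pointMass M := by
    filter_upwards [ae_simplex_weightLaw hs n] with w ⟨hw, h1⟩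
    apply Subtype.ext
    have hc : (Fin.cons M fun _ => M : Fin (n + 1) → ℝ) = fun _ => M := by
      ext i
      exact Fin.cases rfl (fun _ => rfl) i
    refine (coe_atomic hw h1).trans ?_
    simp only [atomicMeasure, hc]
    rw [← Finset.sum_smul, ← ENNReal.ofReal_sum_of_nonneg fun i _ => hw i, h1, ENNReal.ofReal_one,
      one_smul]
    rfl
  rw [atomicKernel_apply, Measure.map_congr hae, Measure.map_const, measure_univ, one_smul]

theorem isDp_dirac_pointMass {s : ℝ} (hs : 0 < s) (M : ℝ) :
    IsDp s (pointMass M) (Measure.dirac (pointMass M)) := by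
  -- the prior is the posterior after an empty sample
  have h := isDirichletProcess_atomicKernel hs M (fun _ : Fin 0 => M)
  rw [atomicKernel_const hs] at h
  simpa [IsDp, updatedBase] using h

/-- Under degenerate priors the data are almost surely constant, and there the posterior is the
prior. -/
theorem isPosterior_atomicKernel {s : ℝ} (hs : 0 < s) (M N : ℝ) (n₁ n₂ : ℕ) :
    IsPosterior ((Measure.dirac (pointMass M)).prod (Measure.dirac (pointMass N)))
      (atomicKernel s M n₁ ∥ₖ atomicKernel s N n₂) := by
  refine ⟨inferInstance, ?_⟩
  have hpi : ∀ (M : ℝ) (n : ℕ), (Measure.pi fun _ : Fin n => (pointMass M : Measure ℝ)) =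
      Measure.dirac fun _ => M := fun M n => by
    change (Measure.pi fun _ : Fin n => Measure.dirac M) = _
    refine Measure.pi_eq fun B hB => ?_
    rw [Measure.dirac_apply' _ (MeasurableSet.univ_pi hB)]
    by_cases h : ∀ i, M ∈ B i
    · simp [Measure.dirac_apply' _ (hB _), h]
    · obtain ⟨i, hi⟩ := not_forall.1 h
      rw [Set.indicator_of_notMem (by simpa using ⟨i, hi⟩),
        Finset.prod_eq_zero (Finset.mem_univ i)]
      simp [Measure.dirac_apply' _ (hB i), hi]
  have hsamp : sampling n₁ n₂ (pointMass M, pointMass N) =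
      Measure.dirac (fun _ => M, fun _ => N) := by
    change (Measure.pi _).prod (Measure.pi _) = _
    rw [hpi, hpi, Measure.dirac_prod_dirac]
  rw [Measure.dirac_prod_dirac, Measure.dirac_bind (sampling n₁ n₂).measurable, hsamp]
  ext A hA
  rw [Measure.compProd_apply hA, lintegral_dirac' _ (Kernel.measurable_kernel_prodMk_left hA),
    Kernel.parallelComp_apply, atomicKernel_const hs, atomicKernel_const hs,
    Measure.dirac_prod_dirac, Measure.dirac_apply' _ (measurable_prodMk_left hA),
    Measure.map_apply measurable_swap hA, Measure.compProd_apply (measurable_swap hA),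
    lintegral_dirac' _ (Kernel.measurable_kernel_prodMk_left (measurable_swap hA)), hsamp,
    Measure.dirac_apply' _ (measurable_prodMk_left (measurable_swap hA))]
  rfl

theorem kernel_mem_posteriors {s : ℝ} (hs : 0 < s) (M N : ℝ) (n₁ n₂ : ℕ) :
    atomicKernel s M n₁ ∥ₖ atomicKernel s N n₂ ∈ posteriors s n₁ n₂ :=
  ⟨pointMass M, pointMass N, _, _, isDp_dirac_pointMass hs M, isDp_dirac_pointMass hs N,
    isPosterior_atomicKernel hs M N n₁ n₂, fun x y => ⟨_, _,
      isDirichletProcess_atomicKernel hs M x, isDirichletProcess_atomicKernel hs N y,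
      Kernel.parallelComp_apply _ _ _⟩⟩

end Mixture

/-! ### The lower probability is attained -/

theorem probLE_atomic {n₁ n₂ : ℕ} {w p : Fin (n₁ + 1) → ℝ} {v q : Fin (n₂ + 1) → ℝ}
    (hw : ∀ i, 0 ≤ w i) (hw1 : ∑ i, w i = 1) (hv : ∀ i, 0 ≤ v i) (hv1 : ∑ i, v i = 1) :
    probLE (atomic (w, p), atomic (v, q)) =
      ∑ i, ∑ k, w i * v k * (Set.Ici (p i)).indicator (fun _ => 1) (q k) := by
  have hms : MeasurableSet {r : ℝ × ℝ | r.1 ≤ r.2} := measurableSet_le measurable_fst measurable_snd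
  have : IsProbabilityMeasure (atomicMeasure (v, q)) := isProbabilityMeasure_atomicMeasure hv hv1
  have hin : ∀ a : ℝ, atomicMeasure (v, q) (Prod.mk a ⁻¹' {r : ℝ × ℝ | r.1 ≤ r.2}) =
      ENNReal.ofReal (∑ k, v k * (Set.Ici a).indicator (fun _ => 1) (q k)) := fun a => by
    rw [ENNReal.ofReal_sum_of_nonneg fun k _ => mul_nonneg (hv k)
      (Set.indicator_nonneg (fun _ _ => zero_le_one) _), atomicMeasure, Measure.finsetSum_apply]
    refine Finset.sum_congr rfl fun k _ => ?_
    rw [Measure.smul_apply, Measure.dirac_apply' _ (measurable_prodMk_left hms)]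
    by_cases h : a ≤ q k <;> simp [h]
  have hnn : ∀ a : ℝ, 0 ≤ ∑ k, v k * (Set.Ici a).indicator (fun _ => 1) (q k) := fun a =>
    Finset.sum_nonneg fun k _ => mul_nonneg (hv k)
      (Set.indicator_nonneg (fun _ _ => zero_le_one) _)
  rw [probLE, coe_atomic hw hw1, coe_atomic hv hv1, measureReal_def, Measure.prod_apply hms]
  conv_lhs => rw [atomicMeasure]
  rw [lintegral_finsetSum_measure]
  simp only [lintegral_smul_measure, lintegral_dirac, hin, smul_eq_mul]
  rw [ENNReal.toReal_sum fun i _ => ENNReal.mul_ne_top ENNReal.ofReal_ne_top ENNReal.ofReal_ne_top]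
  refine Finset.sum_congr rfl fun i _ => ?_
  rw [ENNReal.toReal_mul, ENNReal.toReal_ofReal (hw i), ENNReal.toReal_ofReal (hnn _),
    Finset.mul_sum]
  simp only [mul_assoc]

/-- Prior mass of `X` above and prior mass of `Y` below all observations never contributes to
`P(X ≤ Y)`. -/
theorem probLE_atomic_cons {n₁ n₂ : ℕ} {x : Fin n₁ → ℝ} {y : Fin n₂ → ℝ}
    (noTies : ∀ j k, x j ≠ y k) {N : ℝ} (hN : 0 < N) (hx : ∀ j, -N < x j) (hy : ∀ k, y k < N)
    {w : Fin (n₁ + 1) → ℝ} {v : Fin (n₂ + 1) → ℝ}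
    (hw : ∀ i, 0 ≤ w i) (hw1 : ∑ i, w i = 1) (hv : ∀ i, 0 ≤ v i) (hv1 : ∑ i, v i = 1) :
    probLE (atomic (w, (Fin.cons N x : Fin (n₁ + 1) → ℝ)),
      atomic (v, (Fin.cons (-N) y : Fin (n₂ + 1) → ℝ))) = g x y (w, v) := by
  rw [probLE_atomic hw hw1 hv hv1, Fin.sum_univ_succ]
  simp only [Fin.sum_univ_succ (n := n₂), Fin.cons_zero, Fin.cons_succ, Set.indicator_apply,
    Set.mem_Ici, g, Set.mem_Ioi]
  have h1 : ¬ N ≤ -N := by linarith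
  have h2 : ∀ k, ¬ N ≤ y k := fun k => (hy k).not_ge
  have h3 : ∀ j, ¬ x j ≤ -N := fun j => (hx j).not_ge
  have h4 : ∀ j k, x j ≤ y k ↔ x j < y k := fun j k => (noTies j k).le_iff_lt
  simp [h1, h2, h3, h4]

theorem posterior_prob_atomicKernel {s : ℝ} (hs : 0 < s) (c : ℝ) {n₁ n₂ : ℕ} {x : Fin n₁ → ℝ}
    {y : Fin n₂ → ℝ} (noTies : ∀ j k, x j ≠ y k) {N : ℝ} (hN : 0 < N) (hx : ∀ j, -N < x j)
    (hy : ∀ k, y k < N) :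
    ((atomicKernel s N n₁ ∥ₖ atomicKernel s (-N) n₂) (x, y)).real {F | c < probLE F} =
      ((weightLaw s n₁).prod (weightLaw s n₂)).real {w | c < g x y w} := by
  have hA : ∀ {n : ℕ} (M : ℝ) (x : Fin n → ℝ),
      Measurable fun w => atomic (w, (Fin.cons M x : Fin (n + 1) → ℝ)) := fun _ _ =>
    measurable_atomic_weights _
  rw [Kernel.parallelComp_apply, atomicKernel_apply, atomicKernel_apply,
    Measure.map_prod_map _ _ (hA _ _) (hA _ _), map_measureReal_apply ((hA _ _).prodMap (hA _ _))
      (measurableSet_lt measurable_const measurable_probLE)]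
  refine measureReal_congr ?_
  have h1 := Measure.quasiMeasurePreserving_fst (μ := weightLaw s n₁) (ν := weightLaw s n₂)
    |>.ae (ae_simplex_weightLaw hs n₁)
  have h2 := Measure.quasiMeasurePreserving_snd (μ := weightLaw s n₁) (ν := weightLaw s n₂)
    |>.ae (ae_simplex_weightLaw hs n₂)
  filter_upwards [h1, h2] with w h1 h2
  have h := probLE_atomic_cons noTies hN hx hy h1.1 h1.2 h2.1 h2.2
  apply propext
  change c < probLE _ ↔ c < _
  rw [← h]
  rfl

/-- The lower probability is attained: it is a minimum over the posteriors. -/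
theorem isLeast_posteriorProbs {s : ℝ} (hs : 0 < s) (c : ℝ) {n₁ n₂ : ℕ} {x : Fin n₁ → ℝ}
    {y : Fin n₂ → ℝ} (noTies : ∀ j k, x j ≠ y k) :
    IsLeast (posteriorProbs s c x y)
      (((weightLaw s n₁).prod (weightLaw s n₂)).real {w | c < g x y w}) := by
  obtain ⟨N, hN, hx, hy⟩ : ∃ N : ℝ, 0 < N ∧ (∀ j, -N < x j) ∧ ∀ k, y k < N := by
    refine ⟨∑ j, |x j| + ∑ k, |y k| + 1, by positivity, fun j => ?_, fun k => ?_⟩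
    · have h1 := Finset.single_le_sum (fun j _ => abs_nonneg (x j)) (Finset.mem_univ j)
      have h2 : 0 ≤ ∑ k, |y k| := Finset.sum_nonneg fun k _ => abs_nonneg _
      have h3 := neg_abs_le (x j)
      linarith
    · have h1 := Finset.single_le_sum (fun k _ => abs_nonneg (y k)) (Finset.mem_univ k)
      have h2 : 0 ≤ ∑ j, |x j| := Finset.sum_nonneg fun j _ => abs_nonneg _
      have h3 := le_abs_self (y k)
      linarith
  constructor
  · exact ⟨_, kernel_mem_posteriors hs N (-N) n₁ n₂,
      (posterior_prob_atomicKernel hs c noTies hN hx hy).symm⟩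
  · rintro _ ⟨κ, ⟨G₁, G₂, Q₁, Q₂, -, -, -, hκ⟩, rfl⟩
    obtain ⟨R₁, R₂, h₁, h₂, h⟩ := hκ x y
    rw [h]
    exact le_posterior_prob hs.le c x y h₁ h₂

/-! ### Mean and variance -/

section Moments

variable {s : ℝ} {n₁ n₂ : ℕ} (x : Fin n₁ → ℝ) (y : Fin n₂ → ℝ)

theorem g_eq_sum_compMatrix (w : (Fin (n₁ + 1) → ℝ) × (Fin (n₂ + 1) → ℝ)) :
    g x y w = ∑ j, ∑ k, compMatrix x y j k * (w.1 j.succ * w.2 k.succ) := by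
  simp only [g, compMatrix, of_apply, mul_comm]

theorem integrable_weight (hs : 0 < s) (n : ℕ) (i : Fin (n + 1)) :
    Integrable (fun w => w i) (weightLaw s n) := by
  refine Integrable.of_bound (C := 1) (measurable_pi_apply i).aestronglyMeasurable ?_
  filter_upwards [ae_simplex_weightLaw hs n] with w ⟨hw, h1⟩
  rw [Real.norm_of_nonneg (hw i), ← h1]
  exact Finset.single_le_sum (fun j _ => hw j) (Finset.mem_univ i)

theorem memLp_g (hs : 0 < s) : MemLp (g x y) 2 ((weightLaw s n₁).prod (weightLaw s n₂)) := by
  refine MemLp.of_bound (measurable_g x y).aestronglyMeasurable (n₁ * n₂) ?_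
  have h1 := Measure.quasiMeasurePreserving_fst (μ := weightLaw s n₁) (ν := weightLaw s n₂)
    |>.ae (ae_simplex_weightLaw hs n₁)
  have h2 := Measure.quasiMeasurePreserving_snd (μ := weightLaw s n₁) (ν := weightLaw s n₂)
    |>.ae (ae_simplex_weightLaw hs n₂)
  filter_upwards [h1, h2] with w h1 h2
  have hle : ∀ {n : ℕ} {w : Fin (n + 1) → ℝ}, ((∀ i, 0 ≤ w i) ∧ ∑ i, w i = 1) → ∀ i, w i ≤ 1 :=
    fun h i => h.2 ▸ Finset.single_le_sum (fun j _ => h.1 j) (Finset.mem_univ i)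
  have hterm : ∀ j k, ‖w.1 (Fin.succ j) * w.2 (Fin.succ k) *
      (Set.Ioi (x j)).indicator (fun _ => 1) (y k)‖ ≤ 1 := fun j k => by
    rw [norm_mul, norm_mul, Real.norm_of_nonneg (h1.1 _), Real.norm_of_nonneg (h2.1 _)]
    refine mul_le_one₀ (mul_le_one₀ (hle h1 _) (h2.1 _) (hle h2 _)) (norm_nonneg _) ?_
    by_cases h : x j < y k <;> simp [h]
  calc ‖g x y w‖ ≤ ∑ j : Fin n₁, ∑ k : Fin n₂, (1 : ℝ) :=
        norm_sum_le_of_le _ fun j _ => norm_sum_le_of_le _ fun k _ => hterm j k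
    _ = n₁ * n₂ := by simp

theorem integral_g (hs : 0 < s) :
    ∫ w, g x y w ∂(weightLaw s n₁).prod (weightLaw s n₂) =
      meanVec s n₁ ⬝ᵥ (compMatrix x y *ᵥ meanVec s n₂) := by
  have hi : ∀ j k, Integrable (fun w : (Fin (n₁ + 1) → ℝ) × (Fin (n₂ + 1) → ℝ) =>
      compMatrix x y j k * (w.1 j.succ * w.2 k.succ))
      ((weightLaw s n₁).prod (weightLaw s n₂)) := fun j k =>
    ((integrable_weight hs n₁ j.succ).mul_prod (integrable_weight hs n₂ k.succ)).const_mul _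
  simp only [g_eq_sum_compMatrix]
  rw [integral_finsetSum _ fun j _ => integrable_finsetSum _ fun k _ => hi j k]
  simp only [dotProduct, mulVec, Finset.mul_sum]
  refine Finset.sum_congr rfl fun j _ => ?_
  rw [integral_finsetSum _ fun k _ => hi j k]
  refine Finset.sum_congr rfl fun k _ => ?_
  rw [integral_const_mul, integral_prod_mul (fun w : Fin (n₁ + 1) → ℝ => w j.succ)
    (fun w : Fin (n₂ + 1) → ℝ => w k.succ)]
  simp only [meanVec]
  ring

/-- The entries of `E[W Wᵀ]` and `E[V Vᵀ]` separate in `E[g²]` because the two weight vectors are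
independent. -/
theorem integral_g_sq (hs : 0 < s) :
    ∫ w, g x y w ^ 2 ∂(weightLaw s n₁).prod (weightLaw s n₂) =
      ((compMatrix x y)ᵀ * secondMoment s n₁ * compMatrix x y * secondMoment s n₂).trace := by
  set A := compMatrix x y
  have hm : ∀ (n : ℕ) (j j' : Fin n), Integrable (fun w => w j.succ * w j'.succ)
      (weightLaw s n) := fun n j j' => integrable_mul_dirichlet _ (i₀ := 0) hs _ _
  have hi : ∀ k' k j j', Integrable (fun w : (Fin (n₁ + 1) → ℝ) × (Fin (n₂ + 1) → ℝ) =>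
      A j k' * A j' k * ((w.1 j.succ * w.1 j'.succ) * (w.2 k.succ * w.2 k'.succ)))
      ((weightLaw s n₁).prod (weightLaw s n₂)) := fun k' k j j' =>
    ((hm n₁ j j').mul_prod (hm n₂ k k')).const_mul _
  have hsq : ∀ w : (Fin (n₁ + 1) → ℝ) × (Fin (n₂ + 1) → ℝ), g x y w ^ 2 =
      ∑ k', ∑ k, ∑ j', ∑ j,
        A j k' * A j' k * ((w.1 j.succ * w.1 j'.succ) * (w.2 k.succ * w.2 k'.succ)) := fun w => by
    rw [g_eq_sum_compMatrix, Finset.sum_comm, pow_two, Finset.sum_mul_sum]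
    refine Finset.sum_congr rfl fun k' _ => Finset.sum_congr rfl fun k _ => ?_
    rw [mul_comm, Finset.sum_mul_sum]
    refine Finset.sum_congr rfl fun j' _ => Finset.sum_congr rfl fun j _ => ?_
    ring
  simp only [hsq, Matrix.trace, diag_apply, mul_apply, transpose_apply, Finset.sum_mul]
  rw [integral_finsetSum _ fun k' _ => integrable_finsetSum _ fun k _ =>
    integrable_finsetSum _ fun j' _ => integrable_finsetSum _ fun j _ => hi k' k j j']
  refine Finset.sum_congr rfl fun k' _ => ?_
  rw [integral_finsetSum _ fun k _ => integrable_finsetSum _ fun j' _ =>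
    integrable_finsetSum _ fun j _ => hi k' k j j']
  refine Finset.sum_congr rfl fun k _ => ?_
  rw [integral_finsetSum _ fun j' _ => integrable_finsetSum _ fun j _ => hi k' k j j']
  refine Finset.sum_congr rfl fun j' _ => ?_
  rw [integral_finsetSum _ fun j _ => hi k' k j j']
  refine Finset.sum_congr rfl fun j _ => ?_
  rw [integral_const_mul, integral_prod_mul
    (fun w : Fin (n₁ + 1) → ℝ => w j.succ * w j'.succ)
    (fun w : Fin (n₂ + 1) → ℝ => w k.succ * w k'.succ)]
  simp only [secondMoment, of_apply]
  ring

end Moments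

end IDP

theorem theorem3 (s : ℝ) (hs : 0 < s) (n₁ n₂ : ℕ) (x : Fin n₁ → ℝ) (y : Fin n₂ → ℝ)
    (noTies : ∀ j k, x j ≠ y k) :
    (∀ c ∈ Set.Icc (0 : ℝ) 1,
      (IDP.posteriorProbs s c x y).Nonempty ∧
      IDP.lowerProb s c x y =
        ((IDP.weightLaw s n₁).prod (IDP.weightLaw s n₂)).real {w | c < IDP.g x y w}) ∧
    MemLp (IDP.g x y) 2 ((IDP.weightLaw s n₁).prod (IDP.weightLaw s n₂)) ∧
    (∫ w, IDP.g x y w ∂((IDP.weightLaw s n₁).prod (IDP.weightLaw s n₂)) =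
      IDP.meanVec s n₁ ⬝ᵥ (IDP.compMatrix x y *ᵥ IDP.meanVec s n₂)) ∧
    (variance (IDP.g x y) ((IDP.weightLaw s n₁).prod (IDP.weightLaw s n₂)) =
      ((IDP.compMatrix x y)ᵀ * IDP.secondMoment s n₁ * IDP.compMatrix x y *
          IDP.secondMoment s n₂).trace -
        (IDP.meanVec s n₁ ⬝ᵥ (IDP.compMatrix x y *ᵥ IDP.meanVec s n₂)) ^ 2) ∧
    (∀ j k, IDP.secondMoment s n₁ j k =
      (s + n₁)⁻¹ * (s + n₁ + 1)⁻¹ * (1 + if j = k then 1 else 0)) ∧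
    (∀ j k, IDP.secondMoment s n₂ j k =
      (s + n₂)⁻¹ * (s + n₂ + 1)⁻¹ * (1 + if j = k then 1 else 0)) := by
  have hleast := fun c => IDP.isLeast_posteriorProbs hs c noTies
  refine ⟨fun c _ => ⟨(hleast c).nonempty, (hleast c).csInf_eq⟩, IDP.memLp_g x y hs,
    IDP.integral_g x y hs, ?_, IDP.secondMoment_apply hs n₁, IDP.secondMoment_apply hs n₂⟩
  rw [variance_eq_sub (IDP.memLp_g x y hs), IDP.integral_g x y hs]
  congr 1
  exact IDP.integral_g_sq x y hs
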